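/- A 4-tuple of dimension $n$ is $\sigma=(A,N,b,c)$ with $A,N\in\mathbb R^{n\times n}$, $b\in\mathbb R^{n\times 1}$, $c\in\mathbb R^{1\times n}$. It defines the $n$-dimensional bilinear system of type I $$\dot x=(A+uN)x+bu,\quad x(0)=0,\quad y=cx .$$ Inputs are Lebesgue measurable, essentially bounded functions $u:[0,T]\to\mathbb R$ with $T\ge 0$ depending on $u$. Two systems are indistinguishable under an input $u:[0,T]\to\mathbb R$ if their outputs $y(t)$ agree for all $t\in[0,T]$; they are i/o equivalent if they are indistinguishable under every input. A set of 4-tuples, viewed as a subset of $\mathbb R^{2n^2+2n}$, is generic if it is open and dense and its complement has Lebesgue measure zero. For $\tau\ge 0$ and $\alpha\in\mathbb R$ let $\mathbf u_{\tau,\alpha}(t)=\alpha$ for $0\le t<\tau$ and $\mathbf u_{\tau,\alpha}(t)=0$ for $t\ge\tau$. Theorem. Let $n\ge 2$, $\tau\ge 0$ and $\alpha\in\mathbb R$. There is a generic set $\mathcal S$ of $n$-dimensional bilinear systems of type I such that for every $\sigma\in\mathcal S$ there is some $\widehat\sigma\in\mathcal S$ such that 1. $\sigma$ and $\widehat\sigma$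 are indistinguishable under the pulse $\mathbf u_{\tau,\alpha}$, restricted to $[0,T]$, for every $T\ge 0$, but 2. $\sigma$ and $\widehat\sigma$ are not i/o equivalent. -/

import Mathlib

open MeasureTheory

/-- A 4-tuple `(A, N, b, c)` of dimension `n`: two real `n × n` matrices, a column `b` and a row
`c`. As a topological and measure space this is `ℝ ^ (2 n² + 2 n)`, with Lebesgue measure. -/
abbrev FourTuple (n : ℕ) : Type :=
  (Fin n → Fin n → ℝ) × (Fin n → Fin n → ℝ) × (Fin n → ℝ) × (Fin n → ℝ)

namespace FourTuple

/-- The matrix `A` of the 4-tuple `(A, N, b, c)`. -/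
def A {n : ℕ} (σ : FourTuple n) : Matrix (Fin n) (Fin n) ℝ := Matrix.of σ.1

/-- The matrix `N` of the 4-tuple `(A, N, b, c)`. -/
def N {n : ℕ} (σ : FourTuple n) : Matrix (Fin n) (Fin n) ℝ := Matrix.of σ.2.1

/-- The column vector `b` of the 4-tuple `(A, N, b, c)`. -/
def b {n : ℕ} (σ : FourTuple n) : Fin n → ℝ := σ.2.2.1

/-- The row vector `c` of the 4-tuple `(A, N, b, c)`. -/
def c {n : ℕ} (σ : FourTuple n) : Fin n → ℝ := σ.2.2.2

end FourTuple

/-- A set of 4-tuples is generic if its complement is a Lebesgue null set and it is open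
and dense. -/
def IsGeneric {n : ℕ} (S : Set (FourTuple n)) : Prop :=
  volume Sᶜ = 0 ∧ IsOpen S ∧ Dense S

/-- An input: a Lebesgue measurable, essentially bounded function on an interval `[0, T]`
(the values outside `[0, T]` play no role). -/
structure Input where
  /-- The final time. -/
  T : ℝ
  /-- The input function. -/
  u : ℝ → ℝ
  T_nonneg : 0 ≤ T
  memLp : MemLp u ⊤ (volume.restrict (Set.Icc 0 T))

/-- `x` is the trajectory on `[0, T]` (in the sense of Carathéodory, for measurable inputs) of the
type I bilinear system `x' = (A + u N) x + b u`, `x(0) = 0`, under the input `w = (T, u)`: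
it is continuous and satisfies the integrated equation.
Such a trajectory exists, and is unique on `[0, T]`, for every system and every input. -/
def IsTrajectoryI {n : ℕ} (σ : FourTuple n) (w : Input) (x : ℝ → Fin n → ℝ) : Prop :=
  ContinuousOn x (Set.Icc 0 w.T) ∧
    ∀ t ∈ Set.Icc 0 w.T,
      x t = ∫ s in (0 : ℝ)..t, ((σ.A + w.u s • σ.N).mulVec (x s) + w.u s • σ.b)

/-- The systems of type I given by `σ` and `σ'` are indistinguishable under the input `w`:
the outputs `c x(t)` and `c' x'(t)` agree for all `t` in `[0, T]`. -/
def IndistinguishableI {n m : ℕ} (w : Input) (σ : FourTuple n) (σ' : FourTuple m) : Prop :=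
  ∀ (x : ℝ → Fin n → ℝ) (x' : ℝ → Fin m → ℝ), IsTrajectoryI σ w x → IsTrajectoryI σ' w x' →
    ∀ t ∈ Set.Icc 0 w.T, dotProduct σ.c (x t) = dotProduct σ'.c (x' t)

/-- Input/output equivalence of systems of type I with respect to all inputs in `U`. -/
def IOEquivalentOnI {n m : ℕ} (U : Set Input) (σ : FourTuple n) (σ' : FourTuple m) : Prop :=
  ∀ w ∈ U, IndistinguishableI w σ σ'

/-- Input/output equivalence of systems of type I: equivalence with respect to all inputs. -/
def IOEquivalentI {n m : ℕ} (σ : FourTuple n) (σ' : FourTuple m) : Prop :=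
  IOEquivalentOnI Set.univ σ σ'

/-- The pulse of width `τ` and amplitude `α`: equal to `α` for `t < τ`, and to `0` for `t ≥ τ`. -/
noncomputable def pulse (τ α : ℝ) (t : ℝ) : ℝ := if t < τ then α else 0

theorem memLp_pulse (τ α T : ℝ) : MemLp (pulse τ α) ⊤ (volume.restrict (Set.Icc 0 T)) := by
  refine memLp_top_of_bound ?_ |α| (Filter.Eventually.of_forall fun t => ?_)
  · exact (Measurable.ite measurableSet_Iio measurable_const
      measurable_const).aestronglyMeasurable
  · unfold pulse
    split_ifs <;> simp

/-- The pulse of width `τ` and amplitude `α`, as an input on `[0, T]`. -/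
noncomputable def pulseInput (τ α T : ℝ) (hT : 0 ≤ T) : Input where
  T := T
  u := pulse τ α
  T_nonneg := hT
  memLp := memLp_pulse τ α T

/-! While the pulse is on, only `M = A + α N` and `b` drive the state. Afterwards the output depends
only on `A`, `c` and the state `ξ` reached at time `τ`. So a partner may keep `M`, `b`, `c` and
replace `A` by `P⁻¹ A P`, with `N` adjusted to match, as long as `c P = c` and `P ξ = ξ`: the pulse
response is unchanged.

A rank-one perturbation `P = 1 + v wᵀ` with `c v = 0` and `wᵀ ξ = 0` does this; such `v, w ≠ 0`
exist because `n ≥ 2`. If `P` commuted with `A`, then `v` would be an eigenvector of `A` killed by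
`c`, against observability (`exists_conj_ne`).

Different matrices `A` are told apart by inputs with values `β, 0, β` (`A_eq_of_ioEquivalentI`).
Observability of `(c, M)` recovers the state at the end of the zero phase, its derivative in the
length of that phase gives `A` on reachable states, and these span by controllability of `(M, b)`.

The conditions needed are the nonvanishing of three polynomials in the entries, hence generic
(`isGeneric_regularTuples`). -/

open Filter Topology Set Matrix

/-! ### Affine flows and trajectories under piecewise constant inputs -/

/-- Every affine autonomous linear system has a global solution with prescribed initial value. -/
theorem exists_global_affine_solution {E : Type*} [NormedAddCommGroup E] [NormedSpace ℝ E]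
    [CompleteSpace E] (L : E →L[ℝ] E) (v ξ : E) :
    ∃ x : ℝ → E, x 0 = ξ ∧ ∀ t, HasDerivAt x (L (x t) + v) t := by
  -- Homogenization: an extra coordinate, constantly 1, turns the affine field into a linear one,
  -- solved by the exponential.
  let K : (E × ℝ) →L[ℝ] (E × ℝ) :=
    (L.comp (ContinuousLinearMap.fst ℝ E ℝ) +
      (ContinuousLinearMap.snd ℝ E ℝ).smulRight v).prod 0
  let y : ℝ → E × ℝ := fun t => NormedSpace.exp (t • K) (ξ, 1)
  have hy : ∀ t, HasDerivAt y (K (y t)) t := fun t =>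
    (hasDerivAt_exp_smul_const' K t).clm_apply (hasDerivAt_const t (ξ, (1 : ℝ))) |>.congr_deriv
      (by simp [y])
  have hy0 : y 0 = (ξ, 1) := by simp [y]
  have hsnd : ∀ t, HasDerivAt (fun s => (y s).2) 0 t := fun t => (hy t).snd
  have hone : ∀ t, (y t).2 = 1 := fun t => by
    have := is_const_of_deriv_eq_zero (fun s => (hsnd s).differentiableAt)
      (fun s => (hsnd s).deriv) t 0
    simpa [hy0] using this
  refine ⟨fun t => (y t).1, by simp [hy0], fun t => ?_⟩
  have := (ContinuousLinearMap.fst ℝ E ℝ).hasFDerivAt.comp_hasDerivAt t (hy t)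
  exact this.congr_deriv (by simp [K, hone t])

theorem exists_affine_flow {n : ℕ} (M : Matrix (Fin n) (Fin n) ℝ) (v ξ : Fin n → ℝ) :
    ∃ x : ℝ → Fin n → ℝ, x 0 = ξ ∧ ∀ t, HasDerivAt x (M *ᵥ x t + v) t :=
  exists_global_affine_solution (LinearMap.toContinuousLinearMap M.mulVecLin) v ξ

theorem continuous_mulVec_const {n : ℕ} (M : Matrix (Fin n) (Fin n) ℝ) :
    Continuous fun x : Fin n → ℝ => M *ᵥ x :=
  (LinearMap.toContinuousLinearMap M.mulVecLin).continuous

/-- Uniqueness for affine systems, in terms of right derivatives. -/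
theorem eqOn_of_affine_right_deriv {n : ℕ} (M : Matrix (Fin n) (Fin n) ℝ) (v : Fin n → ℝ)
    {x y : ℝ → Fin n → ℝ} {a b : ℝ} (hx : ContinuousOn x (Icc a b))
    (hx' : ∀ t ∈ Ico a b, HasDerivWithinAt x (M *ᵥ x t + v) (Ici t) t)
    (hy : ContinuousOn y (Icc a b))
    (hy' : ∀ t ∈ Ico a b, HasDerivWithinAt y (M *ᵥ y t + v) (Ici t) t) (h : x a = y a) :
    EqOn x y (Icc a b) := by
  let L := LinearMap.toContinuousLinearMap M.mulVecLin
  have hL : LipschitzWith (‖L‖₊ + 0) fun z : Fin n → ℝ => M *ᵥ z + v :=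
    L.lipschitz.add (LipschitzWith.const v)
  exact ODE_solution_unique_of_mem_Icc_right (v := fun _ z => M *ᵥ z + v) (s := fun _ => univ)
    (fun t _ => hL.lipschitzOnWith) hx hx' (fun _ _ => mem_univ _) hy hy' (fun _ _ => mem_univ _) h

/-- The right-hand side of a bilinear system along a continuous curve is integrable. -/
theorem intervalIntegrable_bilinear_rhs {n : ℕ} (σ : FourTuple n) (w : Input)
    {x : ℝ → Fin n → ℝ} (hx : ContinuousOn x (Icc 0 w.T)) :
    IntervalIntegrable (fun s => (σ.A + w.u s • σ.N) *ᵥ x s + w.u s • σ.b) volume 0 w.T := by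
  rw [intervalIntegrable_iff_integrableOn_Icc_of_le w.T_nonneg]
  have h1 : IntegrableOn (fun s => σ.A *ᵥ x s) (Icc 0 w.T) :=
    ((continuous_mulVec_const σ.A).comp_continuousOn hx).integrableOn_Icc
  have h2 : IntegrableOn (fun s => σ.N *ᵥ x s + σ.b) (Icc 0 w.T) :=
    (((continuous_mulVec_const σ.N).comp_continuousOn hx).add continuousOn_const).integrableOn_Icc
  have h3 : IntegrableOn (fun s => w.u s • (σ.N *ᵥ x s + σ.b)) (Icc 0 w.T) :=
    Integrable.smul_of_top_right h2 w.memLp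
  refine (h1.add h3).congr (Eventually.of_forall fun s => ?_)
  simp [Matrix.add_mulVec, Matrix.smul_mulVec, add_assoc]

/-- For inputs that are constant to the right of each time, the trajectories are the continuous
curves that satisfy the differential equation with right derivatives. -/
theorem isTrajectoryI_iff_right_deriv {n : ℕ} (σ : FourTuple n) (w : Input)
    (hw : ∀ t, ∀ᶠ s in 𝓝[≥] t, w.u s = w.u t) (x : ℝ → Fin n → ℝ) :
    IsTrajectoryI σ w x ↔ ContinuousOn x (Icc 0 w.T) ∧ x 0 = 0 ∧
      ∀ t ∈ Ico 0 w.T,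
        HasDerivWithinAt x ((σ.A + w.u t • σ.N) *ᵥ x t + w.u t • σ.b) (Ici t) t := by
  set f : ℝ → Fin n → ℝ := fun s => (σ.A + w.u s • σ.N) *ᵥ x s + w.u s • σ.b with hf
  constructor
  · rintro ⟨hc, hx⟩
    have hint := intervalIntegrable_bilinear_rhs σ w hc
    refine ⟨hc, by simpa using hx 0 ⟨le_rfl, w.T_nonneg⟩, fun t ht => ?_⟩
    have hIcc : Icc 0 w.T ∈ 𝓝[≥] t := mem_of_superset (Icc_mem_nhdsGE ht.2)
      (Icc_subset_Icc_left ht.1)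
    have hxt : ContinuousWithinAt x (Ici t) t :=
      (hc t ⟨ht.1, ht.2.le⟩).mono_of_mem_nhdsWithin hIcc
    have hft : ContinuousWithinAt f (Ici t) t := by
      have : ContinuousWithinAt (fun s => (σ.A + w.u t • σ.N) *ᵥ x s + w.u t • σ.b) (Ici t) t :=
        ((continuous_mulVec_const _).continuousAt.comp_continuousWithinAt hxt).add
          continuousWithinAt_const
      refine this.congr_of_eventuallyEq ?_ rfl
      filter_upwards [hw t] with s hs
      simp only [hf, hs]
    have hmeas : StronglyMeasurableAtFilter f (𝓝[>] t) :=
      ⟨Ioc 0 w.T, mem_of_superset (Ioc_mem_nhdsGT ht.2) (Ioc_subset_Ioc_left ht.1),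
        hint.1.aestronglyMeasurable⟩
    have hd := intervalIntegral.integral_hasDerivWithinAt_right (s := Ici t) (t := Ioi t)
      (hint.mono_set (by
        rw [uIcc_of_le ht.1, uIcc_of_le w.T_nonneg]; exact Icc_subset_Icc_right ht.2.le))
      hmeas (hft.mono Ioi_subset_Ici_self)
    refine hd.congr_of_eventuallyEq ?_ (hx t ⟨ht.1, ht.2.le⟩)
    filter_upwards [hIcc] with s hs using hx s hs
  · rintro ⟨hc, h0, hd⟩
    refine ⟨hc, fun t ht => ?_⟩
    have hint := intervalIntegrable_bilinear_rhs σ w hc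
    have := intervalIntegral.integral_eq_sub_of_hasDeriv_right_of_le ht.1
      (hc.mono (Icc_subset_Icc_right ht.2))
      (fun s hs => (hd s ⟨hs.1.le, hs.2.trans_le ht.2⟩).mono Ioi_subset_Ici_self)
      (hint.mono_set (by
        rw [uIcc_of_le ht.1, uIcc_of_le w.T_nonneg]; exact Icc_subset_Icc_right ht.2))
    rw [h0, sub_zero] at this
    exact this.symm

theorem pulse_eventually_const (τ α t : ℝ) : ∀ᶠ s in 𝓝[≥] t, pulse τ α s = pulse τ α t := by
  rcases lt_or_ge t τ with h | h
  · filter_upwards [nhdsWithin_le_nhds (Iio_mem_nhds h)] with s hs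
    simp [pulse, h, mem_Iio.1 hs]
  · filter_upwards [self_mem_nhdsWithin] with s hs
    simp [pulse, not_lt.2 h, not_lt.2 (h.trans (mem_Ici.1 hs))]

/-! ### Identically vanishing outputs -/

theorem hasDerivAt_dotProduct {n : ℕ} (c : Fin n → ℝ) {x : ℝ → Fin n → ℝ} {x' : Fin n → ℝ} {t : ℝ}
    (hx : HasDerivAt x x' t) : HasDerivAt (fun s => c ⬝ᵥ x s) (c ⬝ᵥ x') t := by
  simp only [dotProduct]
  exact HasDerivAt.fun_sum fun i _ => (hasDerivAt_pi.1 hx i).const_mul (c i)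

theorem dotProduct_deriv_eq_zero {n : ℕ} {c : Fin n → ℝ} {x x' : ℝ → Fin n → ℝ}
    (hx : ∀ t, HasDerivAt x (x' t) t) (h : ∀ t, 0 ≤ t → c ⬝ᵥ x t = 0) {t : ℝ} (ht : 0 ≤ t) :
    c ⬝ᵥ x' t = 0 := by
  have h1 := (hasDerivAt_dotProduct c (hx t)).hasDerivWithinAt (s := Ici 0)
  have h2 : HasDerivWithinAt (fun s => c ⬝ᵥ x s) 0 (Ici 0) t :=
    (hasDerivWithinAt_const t (Ici 0) (0 : ℝ)).congr (fun s hs => h s hs) (h t ht)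
  exact (uniqueDiffOn_Ici (0 : ℝ) t ht).eq_deriv _ h1 h2

/-- Each differentiation of the vanishing output inserts a factor `M`. At `t = 0` this feeds the
observability hypothesis. -/
theorem vecMul_pow_dotProduct_eq_zero_of_linear {n : ℕ} {M : Matrix (Fin n) (Fin n) ℝ}
    {c : Fin n → ℝ} {d : ℝ → Fin n → ℝ} (hd : ∀ t, HasDerivAt d (M *ᵥ d t) t)
    (h : ∀ t, 0 ≤ t → c ⬝ᵥ d t = 0) (k : ℕ) : ∀ t, 0 ≤ t → (c ᵥ* M ^ k) ⬝ᵥ d t = 0 := by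
  induction k with
  | zero => simpa using h
  | succ k ih =>
    intro t ht
    rw [pow_succ, ← vecMul_vecMul, ← dotProduct_mulVec]
    exact dotProduct_deriv_eq_zero hd ih ht

/-- The derivative `r ⬝ᵥ (M x + v)` vanishes. At `t = 0` it is `r ⬝ᵥ v`, so `r M` annihilates the
trajectory too, and the argument repeats. -/
theorem vecMul_pow_dotProduct_eq_zero_of_affine {n : ℕ} {M : Matrix (Fin n) (Fin n) ℝ}
    {r v : Fin n → ℝ} {x : ℝ → Fin n → ℝ} (hx0 : x 0 = 0)
    (hx : ∀ t, HasDerivAt x (M *ᵥ x t + v) t)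
    (h : ∀ t, 0 ≤ t → r ⬝ᵥ x t = 0) (k : ℕ) : (r ᵥ* M ^ k) ⬝ᵥ v = 0 := by
  have step : ∀ r : Fin n → ℝ, (∀ t, 0 ≤ t → r ⬝ᵥ x t = 0) →
      r ⬝ᵥ v = 0 ∧ ∀ t, 0 ≤ t → (r ᵥ* M) ⬝ᵥ x t = 0 := by
    intro r hr
    have hv : r ⬝ᵥ v = 0 := by simpa [hx0] using dotProduct_deriv_eq_zero hx hr le_rfl
    refine ⟨hv, fun t ht => ?_⟩
    have := dotProduct_deriv_eq_zero hx hr ht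
    rwa [dotProduct_add, hv, add_zero, dotProduct_mulVec] at this
  have hall : ∀ k, ∀ t, 0 ≤ t → (r ᵥ* M ^ k) ⬝ᵥ x t = 0 := by
    intro k
    induction k with
    | zero => simpa using h
    | succ k ih =>
      rw [pow_succ, ← vecMul_vecMul]
      exact (step _ ih).2
  exact (step _ (hall k)).1

/-! ### Recovering `A` from responses to double pulses -/

/-- The signal equal to `β` before `s` and after `s + r`, and to `0` in between. -/
noncomputable def doublePulse (s r β t : ℝ) : ℝ :=
  if s ≤ t then if s + r ≤ t then β else 0 else β

theorem doublePulse_eventually_const (s r β t : ℝ) :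
    ∀ᶠ q in 𝓝[≥] t, doublePulse s r β q = doublePulse s r β t := by
  have key : ∀ a : ℝ, ∀ᶠ q in 𝓝[≥] t, (a ≤ q ↔ a ≤ t) := by
    intro a
    rcases lt_or_ge t a with h | h
    · filter_upwards [nhdsWithin_le_nhds (Iio_mem_nhds h)] with q hq
      simp [not_le.2 h, not_le.2 (mem_Iio.1 hq)]
    · filter_upwards [self_mem_nhdsWithin] with q hq
      simp [h, h.trans (mem_Ici.1 hq)]
  filter_upwards [key s, key (s + r)] with q h1 h2
  simp only [doublePulse, h1, h2]

noncomputable def doublePulseInput (s r β T : ℝ) (hT : 0 ≤ T) : Input where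
  T := T
  u := doublePulse s r β
  T_nonneg := hT
  memLp := by
    refine memLp_top_of_bound ?_ |β| (Eventually.of_forall fun t => ?_)
    · exact (Measurable.ite measurableSet_Ici (Measurable.ite measurableSet_Ici measurable_const
        measurable_const) measurable_const).aestronglyMeasurable
    · unfold doublePulse
      split_ifs <;> simp

theorem isTrajectoryI_doublePulse {n : ℕ} {σ : FourTuple n} {s r β T : ℝ} (hs : 0 ≤ s) (hr : 0 ≤ r)
    (hT : 0 ≤ T) {x y z : ℝ → Fin n → ℝ}
    (hx0 : x 0 = 0) (hx : ∀ t, HasDerivAt x ((σ.A + β • σ.N) *ᵥ x t + β • σ.b) t)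
    (hy0 : y 0 = x s) (hy : ∀ t, HasDerivAt y (σ.A *ᵥ y t) t)
    (hz0 : z 0 = y r) (hz : ∀ t, HasDerivAt z ((σ.A + β • σ.N) *ᵥ z t + β • σ.b) t) :
    IsTrajectoryI σ (doublePulseInput s r β T hT) fun t =>
      if s ≤ t then if s + r ≤ t then z (t - (s + r)) else y (t - s) else x t := by
  have hxc : Continuous x := continuous_iff_continuousAt.2 fun t => (hx t).continuousAt
  have hyc : Continuous y := continuous_iff_continuousAt.2 fun t => (hy t).continuousAt
  have hzc : Continuous z := continuous_iff_continuousAt.2 fun t => (hz t).continuousAt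
  rw [isTrajectoryI_iff_right_deriv _ _ (doublePulse_eventually_const s r β)]
  refine ⟨Continuous.continuousOn ?_, ?_, fun t ht => ?_⟩
  · refine Continuous.if_le (Continuous.if_le (by fun_prop) (by fun_prop) continuous_const
      continuous_id ?_) hxc continuous_const continuous_id ?_
    · rintro t rfl
      simp [hz0]
    · rintro t rfl
      rcases hr.eq_or_lt with rfl | hr
      · simp [hz0, hy0]
      · simp [hr, hy0]
  · rcases hs.eq_or_lt with rfl | hs
    · rcases hr.eq_or_lt with rfl | hr
      · simp [hz0, hy0, hx0]
      · simp [hr, hy0, hx0]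
    · simp [hs, hx0]
  · change HasDerivWithinAt _ ((σ.A + doublePulse s r β t • σ.N) *ᵥ _ +
      doublePulse s r β t • σ.b) _ _
    by_cases h1 : s ≤ t
    · by_cases h2 : s + r ≤ t
      · have hd := (hz (t - (s + r))).comp_sub_const t (s + r) |>.hasDerivWithinAt (s := Ici t)
        simp only [doublePulse, h1, h2, if_true]
        refine hd.congr (fun q hq => ?_) ?_
        · simp [h1.trans (mem_Ici.1 hq), h2.trans (mem_Ici.1 hq)]
        · simp [h1, h2]
      · have hd := (hy (t - s)).comp_sub_const t s |>.hasDerivWithinAt (s := Ici t)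
        simp only [doublePulse, h1, h2, if_true, if_false, zero_smul, add_zero]
        refine hd.congr_of_eventuallyEq ?_ (by simp [h1, h2])
        filter_upwards [self_mem_nhdsWithin,
          nhdsWithin_le_nhds (Iio_mem_nhds (not_le.1 h2))] with q hq hq'
        simp [h1.trans (mem_Ici.1 hq), not_le.2 (mem_Iio.1 hq')]
    · have hd := (hx t).hasDerivWithinAt (s := Ici t)
      simp only [doublePulse, h1, if_false]
      refine hd.congr_of_eventuallyEq ?_ (by simp [h1])
      filter_upwards [nhdsWithin_le_nhds (Iio_mem_nhds (not_le.1 h1))] with q hq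
      simp [not_le.2 (mem_Iio.1 hq)]

/-- Two systems that share `A + β N`, `b` and `c`, which form a controllable and observable
triple, and that are i/o equivalent have the same matrix `A`. -/
theorem A_eq_of_ioEquivalentI {n : ℕ} {σ σ' : FourTuple n} {β : ℝ} (hβ : β ≠ 0)
    {M : Matrix (Fin n) (Fin n) ℝ} (hM : σ.A + β • σ.N = M) (hM' : σ'.A + β • σ'.N = M)
    (hb : σ'.b = σ.b) (hc : σ'.c = σ.c)
    (hctrl : ∀ r : Fin n → ℝ, (∀ k : ℕ, (r ᵥ* M ^ k) ⬝ᵥ σ.b = 0) → r = 0)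
    (hobs : ∀ d : Fin n → ℝ, (∀ k : ℕ, (σ.c ᵥ* M ^ k) ⬝ᵥ d = 0) → d = 0)
    (h : IOEquivalentI σ σ') : σ.A = σ'.A := by
  obtain ⟨x, hx0, hx⟩ := exists_affine_flow M (β • σ.b) 0
  have hAx : ∀ s, 0 ≤ s → σ.A *ᵥ x s = σ'.A *ᵥ x s := by
    intro s hs
    obtain ⟨y, hy0, hy⟩ := exists_affine_flow σ.A 0 (x s)
    obtain ⟨y', hy0', hy'⟩ := exists_affine_flow σ'.A 0 (x s)
    simp only [add_zero] at hy hy'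
    have hyy : ∀ r, 0 ≤ r → y r = y' r := by
      intro r hr
      obtain ⟨z, hz0, hz⟩ := exists_affine_flow M (β • σ.b) (y r)
      obtain ⟨z', hz0', hz'⟩ := exists_affine_flow M (β • σ.b) (y' r)
      -- During the last phase both systems follow the same affine flow, so the difference of states
      -- is linear and unseen by `c`.
      have hout : ∀ q, 0 ≤ q → σ.c ⬝ᵥ (z q - z' q) = 0 := by
        intro q hq
        have hT : 0 ≤ s + r + q := by positivity
        have h1 := isTrajectoryI_doublePulse (σ := σ) hs hr hT hx0 (by rwa [hM]) hy0 hy hz0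
          (by rwa [hM])
        have h2 := isTrajectoryI_doublePulse (σ := σ') hs hr hT hx0 (by rwa [hM', hb]) hy0' hy'
          hz0' (by rwa [hM', hb])
        have := h _ (mem_univ _) _ _ h1 h2 (s + r + q) ⟨hT, le_rfl⟩
        have e1 : s ≤ s + r + q := by linarith
        have e2 : s + r ≤ s + r + q := by linarith
        simp only [e1, e2, if_true, add_sub_cancel_left, hc] at this
        rw [dotProduct_sub, this, sub_self]
      have hd : ∀ q, HasDerivAt (fun q => z q - z' q) (M *ᵥ (z q - z' q)) q := fun q =>
        ((hz q).sub (hz' q)).congr_deriv (by rw [mulVec_sub]; abel)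
      have := hobs _ fun k => vecMul_pow_dotProduct_eq_zero_of_linear hd hout k 0 le_rfl
      rwa [hz0, hz0', sub_eq_zero] at this
    -- The zero-phase curves coincide for `r ≥ 0`; their right derivatives at 0 are `A x(s)` and `A'
    -- x(s)`.
    have h1 := (hy 0).hasDerivWithinAt (s := Ici 0)
    have h2 : HasDerivWithinAt y (σ'.A *ᵥ y' 0) (Ici 0) 0 :=
      (hy' 0).hasDerivWithinAt.congr (fun r hr => hyy r hr) (hyy 0 le_rfl)
    have := (uniqueDiffOn_Ici (0 : ℝ) 0 self_mem_Ici).eq_deriv _ h1 h2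
    rwa [hy0, hy0'] at this
  rw [← sub_eq_zero]
  funext i
  refine hctrl ((σ.A - σ'.A) i) fun k => ?_
  have hrow : ∀ t, 0 ≤ t → (σ.A - σ'.A) i ⬝ᵥ x t = 0 := by
    intro t ht
    change ((σ.A - σ'.A) *ᵥ x t) i = 0
    rw [sub_mulVec, hAx t ht, sub_self]
    rfl
  have := vecMul_pow_dotProduct_eq_zero_of_affine hx0 hx hrow k
  rw [dotProduct_smul, smul_eq_mul] at this
  exact (mul_eq_zero.1 this).resolve_left hβ

/-! ### Genericity of regular tuples -/

/-- A function that is polynomial on each line through a point where it does not vanish has a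
null zero set. -/
theorem measure_zeros_of_polynomial_on_lines {E : Type*} [NormedAddCommGroup E] [NormedSpace ℝ E]
    [FiniteDimensional ℝ E] [MeasurableSpace E] [BorelSpace E] (μ : Measure E)
    [μ.IsAddHaarMeasure] {p : E → ℝ} (hp : Continuous p) {e : E} (he : p e ≠ 0)
    (hpoly : ∀ x, ∃ q : Polynomial ℝ, ∀ t, p (e + t • x) = q.eval t) : μ {x | p x = 0} = 0 := by
  have hcont : Continuous fun z : ℝ × E => p (e + z.1 • z.2) := by fun_prop
  have hms : MeasurableSet {z : E × ℝ | p (e + z.2 • z.1) = 0} :=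
    (isClosed_singleton (x := (0 : ℝ))).preimage (hcont.comp continuous_swap) |>.measurableSet
  have hline : ∀ x, volume {t : ℝ | p (e + t • x) = 0} = 0 := by
    intro x
    obtain ⟨q, hq⟩ := hpoly x
    have hq0 : q ≠ 0 := by
      rintro rfl
      exact he (by simpa using hq 0)
    refine Set.Finite.measure_zero ?_ _
    simp only [hq]
    exact Polynomial.finite_setOfPred_isRoot hq0
  -- Fubini, used in both orders: all sections in `t` are null, so for almost every `t` the section
  -- in `x` is null. One such `t ≠ 0` suffices, as the section is an affine preimage of the zero
  -- set.
  have hprod : (μ.prod (volume : Measure ℝ)) {z : E × ℝ | p (e + z.2 • z.1) = 0} = 0 := by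
    rw [Measure.measure_prod_null hms]
    exact Eventually.of_forall hline
  rw [← Measure.prod_swap, Measure.map_apply measurable_swap hms,
    Measure.measure_prod_null (measurable_swap hms)] at hprod
  have hne : ∀ᵐ t : ℝ, t ≠ 0 := by simp [ae_iff]
  obtain ⟨t, ht, ht0⟩ := (hprod.and hne).exists
  change μ {x | p (e + t • x) = 0} = 0 at ht
  have hset : {x | p (e + t • x) = 0} = (t • ·) ⁻¹' ((e + ·) ⁻¹' {x | p x = 0}) := rfl
  rw [hset, Measure.addHaar_preimage_smul μ ht0, measure_preimage_add] at ht
  exact (mul_eq_zero.1 ht).resolve_left (by simp [ht0])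

/-- The observability matrix, with rows `c`, `c M`, …, `c M ^ (n - 1)`. -/
def obsMatrix {R : Type*} [CommRing R] {n : ℕ} (M : Matrix (Fin n) (Fin n) R) (c : Fin n → R) :
    Matrix (Fin n) (Fin n) R :=
  Matrix.of fun i => c ᵥ* M ^ (i : ℕ)

theorem obsMatrix_map {R S : Type*} [CommRing R] [CommRing S] {n : ℕ} (f : R →+* S)
    (M : Matrix (Fin n) (Fin n) R) (c : Fin n → R) :
    (obsMatrix M c).map f = obsMatrix (M.map f) (f ∘ c) := by
  ext i j
  have : (M.map f) ^ (i : ℕ) = (M ^ (i : ℕ)).map f := (map_pow f.mapMatrix M i).symm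
  simp [obsMatrix, this, RingHom.map_vecMul]

theorem continuous_det_obsMatrix {E : Type*} [TopologicalSpace E] {n : ℕ}
    {F : E → Matrix (Fin n) (Fin n) ℝ} {g : E → Fin n → ℝ} (hF : Continuous F)
    (hg : Continuous g) : Continuous fun x => (obsMatrix (F x) (g x)).det := by
  refine Continuous.matrix_det (continuous_matrix fun i j => ?_)
  simp only [obsMatrix, Matrix.of_apply]
  exact (continuous_apply j).comp (hg.matrix_vecMul (hF.pow _))

theorem det_obsMatrix_diagonal_ne_zero (n : ℕ) :
    (obsMatrix (Matrix.diagonal fun i : Fin n => (i : ℝ)) 1).det ≠ 0 := by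
  have : obsMatrix (Matrix.diagonal fun i : Fin n => (i : ℝ)) 1 =
      (Matrix.vandermonde fun i : Fin n => (i : ℝ))ᵀ := by
    ext i j
    simp [obsMatrix, Matrix.diagonal_pow, Matrix.vecMul_diagonal, Matrix.vandermonde_apply]
  rw [this, Matrix.det_transpose, Matrix.det_vandermonde_ne_zero_iff]
  intro i j h
  exact Fin.ext (Nat.cast_injective (R := ℝ) h)

/-- The determinant is formed over `ℝ[X]` with `X` in place of `t`; evaluation is a ring
homomorphism and commutes with it. -/
theorem exists_polynomial_det_obsMatrix {n : ℕ} (M M' : Matrix (Fin n) (Fin n) ℝ)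
    (c c' : Fin n → ℝ) : ∃ q : Polynomial ℝ, ∀ t : ℝ,
      (obsMatrix (M + t • M') (c + t • c')).det = q.eval t := by
  let C : ℝ →+* Polynomial ℝ := Polynomial.C
  refine ⟨(obsMatrix (M.map C + (Polynomial.X : Polynomial ℝ) • M'.map C)
    (C ∘ c + (Polynomial.X : Polynomial ℝ) • (C ∘ c'))).det, fun t => ?_⟩
  rw [← Polynomial.coe_evalRingHom, RingHom.map_det, RingHom.mapMatrix_apply, obsMatrix_map]
  congr 2
  · ext i j
    simp [C, mul_comm t]
  · ext i
    simp [C, mul_comm t]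

/-- The set of 4-tuples for which `(c, A)` and `(c, A + β N)` are observable and `(A + β N, b)` is
controllable. -/
def regularTuples (n : ℕ) (β : ℝ) : Set (FourTuple n) :=
  {σ | (obsMatrix σ.A σ.c).det ≠ 0 ∧ (obsMatrix (σ.A + β • σ.N) σ.c).det ≠ 0 ∧
    (obsMatrix (σ.A + β • σ.N)ᵀ σ.b).det ≠ 0}

theorem FourTuple.continuous_A {n : ℕ} : Continuous (FourTuple.A (n := n)) := continuous_fst

theorem FourTuple.continuous_N {n : ℕ} : Continuous (FourTuple.N (n := n)) :=
  continuous_fst.comp continuous_snd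

theorem FourTuple.continuous_b {n : ℕ} : Continuous (FourTuple.b (n := n)) :=
  continuous_fst.comp (continuous_snd.comp continuous_snd)

theorem FourTuple.continuous_c {n : ℕ} : Continuous (FourTuple.c (n := n)) :=
  continuous_snd.comp (continuous_snd.comp continuous_snd)

instance isAddHaarMeasure_volume_fourTuple (n : ℕ) :
    (volume : Measure (FourTuple n)).IsAddHaarMeasure := by
  have : (volume : Measure (Fin n → Fin n → ℝ)).IsAddHaarMeasure :=
    Measure.pi.isAddHaarMeasure _
  have h1 : (volume : Measure ((Fin n → ℝ) × (Fin n → ℝ))).IsAddHaarMeasure :=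
    Measure.prod.instIsAddHaarMeasure _ _
  have h2 : (volume : Measure ((Fin n → Fin n → ℝ) × (Fin n → ℝ) × (Fin n → ℝ))).IsAddHaarMeasure :=
    Measure.prod.instIsAddHaarMeasure _ _
  exact Measure.prod.instIsAddHaarMeasure _ _

/-- A tuple for which `A` is diagonal with distinct eigenvalues. -/
noncomputable def diagonalTuple (n : ℕ) : FourTuple n := (fun i j => if i = j then (i : ℝ) else 0, 0, 1, 1)

theorem A_diagonalTuple (n : ℕ) :
    (diagonalTuple n).A = Matrix.diagonal fun i : Fin n => (i : ℝ) := by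
  ext i j
  simp [FourTuple.A, diagonalTuple, Matrix.diagonal_apply]

theorem N_diagonalTuple (n : ℕ) : (diagonalTuple n).N = 0 := rfl

theorem volume_det_obsMatrix_eq_zero {n : ℕ} {F : FourTuple n → Matrix (Fin n) (Fin n) ℝ}
    {g : FourTuple n → Fin n → ℝ} (hF : Continuous F) (hg : Continuous g)
    (hF' : ∀ σ σ' : FourTuple n, ∀ t : ℝ, F (σ + t • σ') = F σ + t • F σ')
    (hg' : ∀ σ σ' : FourTuple n, ∀ t : ℝ, g (σ + t • σ') = g σ + t • g σ')
    (hF0 : F (diagonalTuple n) = Matrix.diagonal fun i : Fin n => (i : ℝ))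
    (hg0 : g (diagonalTuple n) = 1) :
    volume {σ | (obsMatrix (F σ) (g σ)).det = 0} = 0 := by
  refine measure_zeros_of_polynomial_on_lines volume (continuous_det_obsMatrix hF hg)
    (e := diagonalTuple n) ?_ fun σ => ?_
  · rw [hF0, hg0]
    exact det_obsMatrix_diagonal_ne_zero n
  · simp only [hF', hg']
    exact exists_polynomial_det_obsMatrix _ _ _ _

theorem isGeneric_regularTuples (n : ℕ) (β : ℝ) : IsGeneric (regularTuples n β) := by
  have hM : Continuous fun σ : FourTuple n => σ.A + β • σ.N :=
    FourTuple.continuous_A.add (FourTuple.continuous_N.const_smul β)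
  have hlin : ∀ σ σ' : FourTuple n, ∀ t : ℝ, (σ + t • σ').A + β • (σ + t • σ').N =
      σ.A + β • σ.N + t • (σ'.A + β • σ'.N) := by
    intro σ σ' t
    ext i j
    simp [FourTuple.A, FourTuple.N]
    ring
  -- Since `N = 0` here, one tuple witnesses that all three determinants are nonzero, whatever `β`
  -- is.
  have h0 : (diagonalTuple n).A + β • (diagonalTuple n).N =
      Matrix.diagonal fun i : Fin n => (i : ℝ) := by
    rw [N_diagonalTuple, smul_zero, add_zero, A_diagonalTuple]
  have hnull : volume (regularTuples n β)ᶜ = 0 := by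
    have h1 := volume_det_obsMatrix_eq_zero (FourTuple.continuous_A (n := n))
      FourTuple.continuous_c (fun _ _ _ => rfl) (fun _ _ _ => rfl)
      (A_diagonalTuple n) rfl
    have h2 := volume_det_obsMatrix_eq_zero hM FourTuple.continuous_c hlin (fun _ _ _ => rfl)
      h0 rfl
    have h3 := volume_det_obsMatrix_eq_zero hM.matrix_transpose FourTuple.continuous_b
      (fun σ σ' t => by rw [hlin, transpose_add, transpose_smul]) (fun _ _ _ => rfl)
      (by rw [h0, diagonal_transpose]) rfl
    refine measure_mono_null ?_ (measure_union_null h1 (measure_union_null h2 h3))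
    intro σ hσ
    simp only [regularTuples, mem_compl_iff, mem_ofPred_eq, not_and_or, not_not] at hσ
    exact hσ
  refine ⟨hnull, ?_, ?_⟩
  · exact (isOpen_ne_fun (continuous_det_obsMatrix FourTuple.continuous_A FourTuple.continuous_c)
      continuous_const).inter ((isOpen_ne_fun (continuous_det_obsMatrix hM FourTuple.continuous_c)
      continuous_const).inter (isOpen_ne_fun (continuous_det_obsMatrix hM.matrix_transpose
      FourTuple.continuous_b) continuous_const))
  · exact Measure.dense_of_ae (μ := volume) hnull

theorem eq_zero_of_observable {n : ℕ} {M : Matrix (Fin n) (Fin n) ℝ} {c : Fin n → ℝ}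
    (h : (obsMatrix M c).det ≠ 0) {d : Fin n → ℝ} (hd : ∀ k : ℕ, (c ᵥ* M ^ k) ⬝ᵥ d = 0) :
    d = 0 :=
  Matrix.eq_zero_of_mulVec_eq_zero h (funext fun i => hd i)

/-- Duality: controllability of `(M, b)` is observability of `(b, Mᵀ)`. -/
theorem eq_zero_of_controllable {n : ℕ} {M : Matrix (Fin n) (Fin n) ℝ} {b : Fin n → ℝ}
    (h : (obsMatrix Mᵀ b).det ≠ 0) {r : Fin n → ℝ} (hr : ∀ k : ℕ, (r ᵥ* M ^ k) ⬝ᵥ b = 0) :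
    r = 0 :=
  eq_zero_of_observable h fun k => by
    rw [← transpose_pow, vecMul_transpose, dotProduct_comm, dotProduct_mulVec, hr]

/-! ### Rank-one changes of basis -/

/-- Every vector of a space of dimension at least two is annihilated by a nonzero row. -/
theorem exists_ne_zero_and_dotProduct_eq_zero {n : ℕ} (hn : 2 ≤ n) (c : Fin n → ℝ) :
    ∃ v : Fin n → ℝ, v ≠ 0 ∧ c ⬝ᵥ v = 0 := by
  have hdet : (Matrix.of fun _ : Fin n => c).det = 0 :=
    Matrix.det_zero_of_row_eq (i := ⟨0, by omega⟩) (j := ⟨1, by omega⟩) (by simp) rfl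
  obtain ⟨v, hv, h⟩ := Matrix.exists_mulVec_eq_zero_iff.2 hdet
  exact ⟨v, hv, congrFun h ⟨0, by omega⟩⟩

/-- If `(c, A)` is observable, some change of basis fixes `c` and a given vector, but not `A`. -/
theorem exists_conj_ne {n : ℕ} (hn : 2 ≤ n) {A : Matrix (Fin n) (Fin n) ℝ} {c : Fin n → ℝ}
    (hobs : (obsMatrix A c).det ≠ 0) (ξ : Fin n → ℝ) :
    ∃ P Q : Matrix (Fin n) (Fin n) ℝ, P * Q = 1 ∧ Q * P = 1 ∧ P *ᵥ ξ = ξ ∧ c ᵥ* P = c ∧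
      Q * A * P ≠ A := by
  obtain ⟨v, hv, hcv⟩ := exists_ne_zero_and_dotProduct_eq_zero hn c
  obtain ⟨w, hw, hξw, hwv⟩ : ∃ w : Fin n → ℝ, w ≠ 0 ∧ w ⬝ᵥ ξ = 0 ∧ 1 + w ⬝ᵥ v ≠ 0 := by
    obtain ⟨w, hw, h⟩ := exists_ne_zero_and_dotProduct_eq_zero hn ξ
    rw [dotProduct_comm] at h
    -- If `w ⬝ᵥ v = -1`, then `-w` works, giving `1 + 1 = 2`.
    by_cases h1 : 1 + w ⬝ᵥ v = 0
    · refine ⟨-w, neg_ne_zero.2 hw, by simp [h], ?_⟩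
      rw [neg_dotProduct]
      intro h2
      linarith
    · exact ⟨w, hw, h, h1⟩
  set V := vecMulVec v w with hV
  have hVV : V * V = (w ⬝ᵥ v) • V := by
    rw [hV, vecMulVec_mul_vecMulVec]
    ext i j
    simp [vecMulVec_apply]
    ring
  -- Sherman–Morrison inverse of `1 + v wᵀ`.
  have hPQ : (1 + V) * (1 - (1 + w ⬝ᵥ v)⁻¹ • V) = 1 := by
    rw [add_mul, mul_sub, mul_sub, mul_smul_comm, mul_smul_comm, hVV, smul_smul]
    simp only [one_mul, mul_one]
    have : V = ((1 + w ⬝ᵥ v)⁻¹ + (1 + w ⬝ᵥ v)⁻¹ * (w ⬝ᵥ v)) • V := by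
      rw [← mul_one_add, inv_mul_cancel₀ hwv, one_smul]
    rw [add_smul] at this
    nth_rewrite 2 [this]
    abel
  have hQP := mul_eq_one_comm.1 hPQ
  refine ⟨1 + V, _, hPQ, hQP, ?_, ?_, fun h => hv ?_⟩
  · rw [add_mulVec, one_mulVec, hV, vecMulVec_mulVec, hξw]
    simp
  · rw [vecMul_add, vecMul_one, hV, vecMul_vecMulVec, hcv]
    simp
  · have hcomm : A * V = V * A := by
      have : (1 + V) * A = A * (1 + V) := by
        nth_rewrite 1 [← h]
        rw [← mul_assoc, ← mul_assoc, hPQ, one_mul]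
      rw [add_mul, mul_add, one_mul, mul_one] at this
      exact (add_left_cancel this).symm
    -- Column `j` of `A v wᵀ = v wᵀ A`, with `w j ≠ 0`, exhibits `v` as an eigenvector of `A`.
    obtain ⟨j, hj⟩ := Function.ne_iff.1 hw
    rw [Pi.zero_apply] at hj
    have hAv : A *ᵥ v = ((w ᵥ* A) j / w j) • v := by
      ext i
      have := congrFun (congrFun hcomm i) j
      rw [hV, mul_vecMulVec, vecMulVec_mul, vecMulVec_apply, vecMulVec_apply] at this
      rw [Pi.smul_apply, smul_eq_mul]
      field_simp
      linarith
    have hpow : ∀ k : ℕ, A ^ k *ᵥ v = ((w ᵥ* A) j / w j) ^ k • v := by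
      intro k
      induction k with
      | zero => simp
      | succ k ih => rw [pow_succ, ← mulVec_mulVec, hAv, mulVec_smul, ih, smul_smul, pow_succ']
    refine eq_zero_of_observable hobs fun k => ?_
    rw [← dotProduct_mulVec, hpow, dotProduct_smul, hcv, smul_zero]

/-- As `Q` also fixes `c`, one has `c (Q A P) ^ k = c A ^ k P`. Hence observability passes to the
partner. -/
theorem obsMatrix_conj {n : ℕ} {A P Q : Matrix (Fin n) (Fin n) ℝ} {c : Fin n → ℝ}
    (hPQ : P * Q = 1) (hQP : Q * P = 1) (hc : c ᵥ* P = c) :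
    obsMatrix (Q * A * P) c = obsMatrix A c * P := by
  have hcQ : c ᵥ* Q = c := by
    nth_rewrite 1 [← hc]
    rw [vecMul_vecMul, hPQ, vecMul_one]
  have hpow : ∀ k : ℕ, (Q * A * P) ^ k = Q * A ^ k * P := by
    intro k
    induction k with
    | zero => simp [hQP]
    | succ k ih =>
      rw [pow_succ, ih, pow_succ]
      calc Q * A ^ k * P * (Q * A * P) = Q * A ^ k * (P * Q) * A * P := by noncomm_ring
        _ = Q * (A ^ k * A) * P := by rw [hPQ]; noncomm_ring
  funext i
  change c ᵥ* (Q * A * P) ^ (i : ℕ) = (c ᵥ* A ^ (i : ℕ)) ᵥ* P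
  rw [hpow, ← vecMul_vecMul, ← vecMul_vecMul, hcQ]

/-! ### Indistinguishability under the pulse -/

/-- Once the input vanishes, systems conjugate by a matrix that fixes `c` and matches the states
have the same output. -/
theorem output_eq_of_conj {n : ℕ} {A A' P : Matrix (Fin n) (Fin n) ℝ} {c : Fin n → ℝ}
    (hA : P * A' = A * P) (hc : c ᵥ* P = c) {x x' : ℝ → Fin n → ℝ} {a T : ℝ}
    (hx : ContinuousOn x (Icc a T))
    (hxd : ∀ t ∈ Ico a T, HasDerivWithinAt x (A *ᵥ x t) (Ici t) t)
    (hx' : ContinuousOn x' (Icc a T))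
    (hxd' : ∀ t ∈ Ico a T, HasDerivWithinAt x' (A' *ᵥ x' t) (Ici t) t)
    (h : x a = P *ᵥ x' a) {t : ℝ} (ht : t ∈ Icc a T) : c ⬝ᵥ x t = c ⬝ᵥ x' t := by
  have heq := eqOn_of_affine_right_deriv A 0 (y := fun s => P *ᵥ x' s) hx
    (by simpa using hxd) ((continuous_mulVec_const P).comp_continuousOn hx')
    (fun s hs => by
      have := (LinearMap.toContinuousLinearMap P.mulVecLin).hasFDerivAt.comp_hasDerivWithinAt s
        (hxd' s hs)
      refine this.congr_deriv ?_
      simp [hA]) h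
  rw [heq ht, dotProduct_mulVec, hc]

/-- Conjugate systems are indistinguishable under a pulse of amplitude zero. -/
theorem indistinguishableI_pulse_zero {n : ℕ} {σ σ' : FourTuple n} {P : Matrix (Fin n) (Fin n) ℝ}
    (hA : P * σ'.A = σ.A * P) (hc : σ.c ᵥ* P = σ.c) (hc' : σ'.c = σ.c) (τ T : ℝ) (hT : 0 ≤ T) :
    IndistinguishableI (pulseInput τ 0 T hT) σ σ' := by
  intro x x' hx hx' t ht
  rw [isTrajectoryI_iff_right_deriv _ _ (pulse_eventually_const τ 0)] at hx hx'
  have hu : ∀ t, (pulseInput τ 0 T hT).u t = 0 := fun t => ite_self 0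
  simp only [hu, zero_smul, add_zero] at hx hx'
  rw [hc']
  exact output_eq_of_conj hA hc hx.1 hx.2.2 hx'.1 hx'.2.2 (by rw [hx.2.1, hx'.2.1, mulVec_zero]) ht

/-- Systems that agree while the pulse is on, and that are conjugate by a matrix that fixes `c` and
the state at the end of the pulse, are indistinguishable under the pulse. -/
theorem indistinguishableI_pulse {n : ℕ} {σ σ' : FourTuple n} {P M : Matrix (Fin n) (Fin n) ℝ}
    {τ α : ℝ} (hτ : 0 ≤ τ) (hM : σ.A + α • σ.N = M) (hM' : σ'.A + α • σ'.N = M)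
    (hb : σ'.b = σ.b) (hA : P * σ'.A = σ.A * P) (hc : σ.c ᵥ* P = σ.c) (hc' : σ'.c = σ.c)
    {φ : ℝ → Fin n → ℝ} (hφ0 : φ 0 = 0) (hφ : ∀ t, HasDerivAt φ (M *ᵥ φ t + α • σ.b) t)
    (hP : P *ᵥ φ τ = φ τ) (T : ℝ) (hT : 0 ≤ T) :
    IndistinguishableI (pulseInput τ α T hT) σ σ' := by
  intro x x' hx hx' t ht
  rw [isTrajectoryI_iff_right_deriv _ _ (pulse_eventually_const τ α)] at hx hx'
  obtain ⟨hxc, hx0, hxd⟩ := hx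
  obtain ⟨hxc', hx0', hxd'⟩ := hx'
  change ContinuousOn _ (Icc 0 T) at hxc hxc'
  change t ∈ Icc 0 T at ht
  have hφc : Continuous φ := continuous_iff_continuousAt.2 fun t => (hφ t).continuousAt
  have on_pulse : ∀ {ρ : FourTuple n} {y : ℝ → Fin n → ℝ}, ρ.A + α • ρ.N = M → ρ.b = σ.b →
      ContinuousOn y (Icc 0 T) → y 0 = 0 →
      (∀ t ∈ Ico 0 (pulseInput τ α T hT).T, HasDerivWithinAt y
        ((ρ.A + (pulseInput τ α T hT).u t • ρ.N) *ᵥ y t + (pulseInput τ α T hT).u t • ρ.b)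
        (Ici t) t) → EqOn y φ (Icc 0 (min τ T)) := by
    intro ρ y hρ hρb hyc hy0 hyd
    refine eqOn_of_affine_right_deriv M (α • σ.b) (hyc.mono (Icc_subset_Icc_right (min_le_right _ _)))
      (fun s hs => ?_) hφc.continuousOn (fun s _ => (hφ s).hasDerivWithinAt) (hy0.trans hφ0.symm)
    have hu : (pulseInput τ α T hT).u s = α := if_pos (hs.2.trans_le (min_le_left _ _))
    have := hyd s ⟨hs.1, hs.2.trans_le (min_le_right _ _)⟩
    rwa [hu, hρ, hρb] at this
  have h1 := on_pulse hM rfl hxc hx0 hxd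
  have h2 := on_pulse hM' hb hxc' hx0' hxd'
  rw [hc']
  rcases le_total t τ with htτ | htτ
  · rw [h1 ⟨ht.1, le_min htτ ht.2⟩, h2 ⟨ht.1, le_min htτ ht.2⟩]
  · have hτm : τ ∈ Icc 0 (min τ T) := ⟨hτ, le_min le_rfl (htτ.trans ht.2)⟩
    have after : ∀ s ∈ Ico τ T, (pulseInput τ α T hT).u s = 0 := fun s hs => if_neg (not_lt.2 hs.1)
    refine output_eq_of_conj hA hc (hxc.mono (Icc_subset_Icc_left hτ)) (fun s hs => ?_)
      (hxc'.mono (Icc_subset_Icc_left hτ)) (fun s hs => ?_) ?_ ⟨htτ, ht.2⟩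
    · simpa [after s hs] using hxd s ⟨hτ.trans hs.1, hs.2⟩
    · simpa [after s hs] using hxd' s ⟨hτ.trans hs.1, hs.2⟩
    · rw [h1 hτm, h2 hτm, hP]

/-! ### The partner system and the theorem -/

/-- Each regular tuple has a regular partner with the same `A + β N`, `b` and `c`, whose matrix `A`
is conjugate by a matrix that fixes `c` and a given vector, but which is not i/o equivalent. -/
theorem exists_conj_not_ioEquivalentI {n : ℕ} (hn : 2 ≤ n) {β : ℝ} (hβ : β ≠ 0) {σ : FourTuple n}
    (hσ : σ ∈ regularTuples n β) (ξ : Fin n → ℝ) :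
    ∃ σ' ∈ regularTuples n β, ∃ P : Matrix (Fin n) (Fin n) ℝ,
      σ'.A + β • σ'.N = σ.A + β • σ.N ∧ σ'.b = σ.b ∧ σ'.c = σ.c ∧ P * σ'.A = σ.A * P ∧
        σ.c ᵥ* P = σ.c ∧ P *ᵥ ξ = ξ ∧ ¬ IOEquivalentI σ σ' := by
  obtain ⟨hA, hM, hctrl⟩ := hσ
  obtain ⟨P, Q, hPQ, hQP, hPξ, hcP, hne⟩ := exists_conj_ne hn hA ξ
  -- The second entry solves `A' + β N' = A + β N` for `N'`.
  let σ' : FourTuple n := (Q * σ.A * P, β⁻¹ • (σ.A + β • σ.N - Q * σ.A * P), σ.b, σ.c)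
  have hA' : σ'.A = Q * σ.A * P := rfl
  have hN' : σ'.N = β⁻¹ • (σ.A + β • σ.N - Q * σ.A * P) := rfl
  have hM' : σ'.A + β • σ'.N = σ.A + β • σ.N := by
    rw [hA', hN', smul_smul, mul_inv_cancel₀ hβ, one_smul]
    abel
  have hb : σ'.b = σ.b := rfl
  have hc : σ'.c = σ.c := rfl
  refine ⟨σ', ⟨?_, ?_, ?_⟩, P, hM', hb, hc, ?_, hcP, hPξ, fun h => hne ?_⟩
  · rw [hA', hc, obsMatrix_conj hPQ hQP hcP, det_mul]
    refine mul_ne_zero hA fun h0 => ?_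
    have := congrArg Matrix.det hPQ
    simp [h0] at this
  · rwa [hM', hc]
  · rwa [hM', hb]
  · rw [hA', ← mul_assoc, ← mul_assoc, hPQ, one_mul]
  · exact (A_eq_of_ioEquivalentI hβ rfl hM' hb hc (fun _ => eq_zero_of_controllable hctrl)
      (fun _ => eq_zero_of_observable hM) h).symm

theorem theorem1 (n : ℕ) (hn : 2 ≤ n) (τ : ℝ) (hτ : 0 ≤ τ) (α : ℝ) :
    ∃ S : Set (FourTuple n), IsGeneric S ∧
      ∀ σ ∈ S, ∃ σ' ∈ S,
        (∀ (T : ℝ) (hT : 0 ≤ T), IOEquivalentOnI {pulseInput τ α T hT} σ σ') ∧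
          ¬ IOEquivalentI σ σ' := by
  by_cases hα : α = 0
  · subst hα
    -- The input is zero and the state stays at 0, so no vector has to be matched and any nonzero
    -- `β` would do.
    refine ⟨_, isGeneric_regularTuples n 1, fun σ hσ => ?_⟩
    obtain ⟨σ', hσ', P, -, -, hc, hA, hcP, -, hne⟩ :=
      exists_conj_not_ioEquivalentI hn one_ne_zero hσ 0
    refine ⟨σ', hσ', fun T hT w hw => ?_, hne⟩
    rw [mem_singleton_iff.1 hw]
    exact indistinguishableI_pulse_zero hA hcP hc τ T hT
  · refine ⟨_, isGeneric_regularTuples n α, fun σ hσ => ?_⟩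
    obtain ⟨φ, hφ0, hφ⟩ := exists_affine_flow (σ.A + α • σ.N) (α • σ.b) 0
    obtain ⟨σ', hσ', P, hM, hb, hc, hA, hcP, hP, hne⟩ :=
      exists_conj_not_ioEquivalentI hn hα hσ (φ τ)
    refine ⟨σ', hσ', fun T hT w hw => ?_, hne⟩
    rw [mem_singleton_iff.1 hw]
    exact indistinguishableI_pulse hτ rfl hM hb hA hcP hc hφ0 hφ hP T hT
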